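/- Let $G$ be a group and $\varphi$ an automorphism of $G$. Elements $g,f\in G$ are called $\varphi$-twisted conjugate if $\varphi(x)\,g=f\,x$ for some $x\in G$; the number $R(\varphi)\in\{1,2,\dots\}\cup\{\infty\}$ of equivalence classes of this relation is the Reidemeister number of $\varphi$. The group $G$ has the $R_\infty$ property if $R(\varphi)=\infty$ for every automorphism $\varphi$ of $G$. For integers $r,t\ge 1$ let $S_{rt}=F_r/F_r^{(t)}$ be the free solvable group of rank $r$ and class (derived length) $t$, where $F_r$ is the free group of rank $r$ and $F_r^{(0)}=F_r$, $F_r^{(n+1)}=[F_r^{(n)},F_r^{(n)}]$ is its derived series. **Theorem 2.** (1) For every $t\ge 2$ the group $S_{2t}$ has the $R_\infty$ property; in particular, the free metabelian group $M_2=S_{22}$ of rank $2$ has the $R_\infty$ property. (2) For every $t\ge 4$ the group $S_{3t}$ has the $R_\infty$ property. (3) For all integers $r\ge 4$ and $t\ge\log_2(2r+1)$ the group $S_{rt}$ has the $R_\infty$ property. -/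

import Mathlib

/-- The elements `g`, `f` of `G` are `φ`-twisted conjugate when `φ x * g = f * x` for some
`x : G`. This is the resulting equivalence relation on `G`. -/
def twistedConjSetoid {G : Type*} [Group G] (φ : G ≃* G) : Setoid G where
  r g f := ∃ x : G, φ x * g = f * x
  iseqv :=
    { refl := fun g => ⟨1, by simp⟩
      symm := by
        rintro g f ⟨x, hx⟩
        refine ⟨x⁻¹, ?_⟩
        rw [map_inv, inv_mul_eq_iff_eq_mul, ← mul_assoc, hx, mul_inv_cancel_right]
      trans := by
        rintro g f h ⟨x, hx⟩ ⟨y, hy⟩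
        refine ⟨y * x, ?_⟩
        rw [map_mul, mul_assoc, hx, ← mul_assoc, hy, mul_assoc] }

/-- The Reidemeister number `R(φ)`: the number of `φ`-twisted conjugacy classes,
a natural number or `∞`. -/
noncomputable def reidemeisterNumber {G : Type*} [Group G] (φ : G ≃* G) : ℕ∞ :=
  ENat.card (Quotient (twistedConjSetoid φ))

/-- `G` has the `R_∞` property: `R(φ) = ∞` for every automorphism `φ` of `G`. -/
def HasRInfty (G : Type*) [Group G] : Prop :=
  ∀ φ : G ≃* G, reidemeisterNumber φ = ⊤

/-- The free solvable group `S_{rt}` of rank `r` and class (derived length) `t`: the quotient of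
the free group `F` of rank `r` by the `t`-th term of its derived series `F^(0) = F`,
`F^(n+1) = [F^(n), F^(n)]`. -/
abbrev FreeSolvableGroup (r t : ℕ) : Type :=
  FreeGroup (Fin r) ⧸ derivedSeries (FreeGroup (Fin r)) t

/-- The free metabelian group `M_r` of rank `r`, i.e. the free solvable group of class two. -/
abbrev FreeMetabelianGroup (r : ℕ) : Type := FreeSolvableGroup r 2

/-!
Fix a group `G` and a field `K` of characteristic zero. Functions of bounded degree on `G` are those
killed by sufficiently many differences, and the elements of `G` that functions of degree less than
`n` do not distinguish from `1` form the `n`-th dimension subgroup. If `φ` fixes a nontrivial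
character of a layer of this filtration, then in the least such layer `φ - 1` is invertible on all
earlier ones, so the character separates twisted conjugacy classes and `R(φ) = ∞`.

For `G = F / N` with `N ≤ F''`, a 1-form on the lattice of exponent sums can be integrated along the
path traced out by a word, because the Magnus wreath product is metabelian. The integral of a form
of degree `k + 1` has degree `k + 2` on `G`; it gives a nontrivial character of a layer when the
discrete curl of the form has degree `k`, and `φ` fixes this character when the form is invariant
under the matrix `M` of `φ`. Invariant forms exist over `ℂ` because `det M ^ 2 = 1`. If `M` has two
distinct eigenvalues, let `l_i` run through left eigenvectors for all eigenvalues taken twice, and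
use one of them as the direction and the product of the others as the coefficient. If `M` has a
single eigenvalue `λ`, then `λ ^ 2 = 1` and the form is `g df - f dg` with `f` an eigenvector and
`g` an eigenvector modulo `f`.
-/

section PolynomialFunctions

variable {G H K : Type*} [Group G] [Group H] [CommRing K]

/-- The left difference operator `f ↦ (h ↦ f (g * h) - f h)` on functions on a group. -/
def leftDiff (K : Type*) [CommRing K] (g : G) : (G → K) →ₗ[K] (G → K) :=
  LinearMap.funLeft K K (g * ·) - LinearMap.id

/-- The functions of degree less than `n` on a group, in the sense of Passi: those killed by any
`n` successive left differences. The strict bound makes room for the zero space at `n = 0`. -/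
def polyFun (G K : Type*) [Group G] [CommRing K] : ℕ → Submodule K (G → K)
  | 0 => ⊥
  | n + 1 => ⨅ g, (polyFun G K n).comap (leftDiff K g)

theorem mem_polyFun_succ {n : ℕ} {f : G → K} :
    f ∈ polyFun G K (n + 1) ↔ ∀ g, (fun h => f (g * h) - f h) ∈ polyFun G K n :=
  Submodule.mem_iInf _

theorem const_mem_polyFun (n : ℕ) (c : K) : (fun _ : G => c) ∈ polyFun G K (n + 1) :=
  mem_polyFun_succ.2 fun _ => by
    simp only [sub_self]
    exact (polyFun G K n).zero_mem

theorem polyFun_mono : Monotone (polyFun G K) := by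
  refine monotone_nat_of_le_succ fun n => ?_
  induction n with
  | zero => exact bot_le
  | succ n ih => exact fun f hf => mem_polyFun_succ.2 fun g => ih (mem_polyFun_succ.1 hf g)

theorem comp_mul_left_mem_polyFun {n : ℕ} {f : G → K} (hf : f ∈ polyFun G K n) (g : G) :
    (fun h => f (g * h)) ∈ polyFun G K n := by
  convert (polyFun G K n).add_mem (mem_polyFun_succ.1 (polyFun_mono n.le_succ hf) g) hf using 1
  exact funext fun h => (sub_add_cancel _ _).symm

theorem comp_mul_right_mem_polyFun {n : ℕ} {f : G → K} (hf : f ∈ polyFun G K n) (g : G) :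
    (fun h => f (h * g)) ∈ polyFun G K n := by
  induction n generalizing f with
  | zero => exact funext fun h => congrFun hf (h * g)
  | succ n ih =>
    refine mem_polyFun_succ.2 fun x => ?_
    simpa only [mul_assoc] using ih (mem_polyFun_succ.1 hf x)

theorem eq_of_mem_polyFun_one {f : G → K} (hf : f ∈ polyFun G K 1) (g h : G) : f g = f h := by
  have hleft : ∀ x, f x = f 1 := fun x => by
    simpa only [mul_one] using sub_eq_zero.1 (congrFun (mem_polyFun_succ.1 hf x) 1)
  rw [hleft g, hleft h]

theorem rightDiff_mem_polyFun {n : ℕ} {f : G → K} (hf : f ∈ polyFun G K (n + 1)) (g : G) :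
    (fun h => f (h * g) - f h) ∈ polyFun G K n := by
  induction n generalizing f with
  | zero => exact funext fun h => sub_eq_zero.2 (eq_of_mem_polyFun_one hf _ _)
  | succ n ih =>
    refine mem_polyFun_succ.2 fun x => ?_
    convert ih (mem_polyFun_succ.1 hf x) using 1
    ext h
    simp only [mul_assoc]
    ring

theorem comp_hom_mem_polyFun {n : ℕ} {f : H → K} (hf : f ∈ polyFun H K n) (ψ : G →* H) :
    (fun g => f (ψ g)) ∈ polyFun G K n := by
  induction n generalizing f with
  | zero => exact funext fun g => congrFun hf (ψ g)
  | succ n ih =>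
    refine mem_polyFun_succ.2 fun g => ?_
    simpa only [map_mul] using ih (mem_polyFun_succ.1 hf (ψ g))

theorem additive_mul_mem_polyFun {n : ℕ} {l f : G → K} (hl : ∀ x y, l (x * y) = l x + l y)
    (hf : f ∈ polyFun G K n) : (fun g => l g * f g) ∈ polyFun G K (n + 1) := by
  induction n generalizing f with
  | zero =>
    obtain rfl : f = 0 := hf
    simpa only [Pi.zero_apply, mul_zero] using const_mem_polyFun 0 (0 : K)
  | succ n ih =>
    refine mem_polyFun_succ.2 fun g => ?_
    convert (polyFun G K (n + 1)).add_mem (ih (mem_polyFun_succ.1 hf g))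
      ((polyFun G K (n + 1)).smul_mem (l g) (comp_mul_left_mem_polyFun hf g)) using 1
    ext h
    simp only [hl, Pi.add_apply, Pi.smul_apply, smul_eq_mul]
    ring

theorem prod_additive_mem_polyFun {ι : Type*} (S : Finset ι) {l : ι → G → K}
    (hl : ∀ i x y, l i (x * y) = l i x + l i y) :
    (fun g => ∏ i ∈ S, l i g) ∈ polyFun G K (S.card + 1) := by
  classical
  induction S using Finset.induction_on with
  | empty => exact const_mem_polyFun 0 (1 : K)
  | insert a S ha ih =>
    simp only [Finset.prod_insert ha, Finset.card_insert_of_notMem ha]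
    exact additive_mul_mem_polyFun (hl a) ih

theorem rightDiff_prod_additive_sub_mem_polyFun {ι : Type*} [DecidableEq ι] (S : Finset ι)
    {l : ι → G → K} (hl : ∀ i x y, l i (x * y) = l i x + l i y) (x : G) :
    (fun g => ∏ i ∈ S, l i (g * x) - ∏ i ∈ S, l i g - ∑ i ∈ S, l i x * ∏ j ∈ S.erase i, l j g) ∈
      polyFun G K (S.card - 1) := by
  induction S using Finset.induction_on with
  | empty =>
    simp only [Finset.prod_empty, Finset.sum_empty, sub_self]
    exact Submodule.zero_mem _
  | insert a S ha ih =>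
    have hsum (g : G) : ∑ i ∈ S, l i x * ∏ j ∈ (insert a S).erase i, l j g =
        l a g * ∑ i ∈ S, l i x * ∏ j ∈ S.erase i, l j g := by
      rw [Finset.mul_sum]
      refine Finset.sum_congr rfl fun i hi => ?_
      rw [Finset.erase_insert_of_ne (ne_of_mem_of_not_mem hi ha).symm,
        Finset.prod_insert fun h => ha (Finset.mem_of_mem_erase h)]
      ring
    have hsplit := (polyFun G K S.card).smul_mem (l a x)
      (rightDiff_mem_polyFun (prod_additive_mem_polyFun S hl) x)
    rw [Finset.card_insert_of_notMem ha, Nat.add_sub_cancel]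
    simp only [Finset.prod_insert ha, Finset.sum_insert ha, Finset.erase_insert ha, hsum, hl a]
    rcases S.eq_empty_or_nonempty with rfl | hS
    · convert hsplit using 1
      ext g
      simp
    · have hmul := additive_mul_mem_polyFun (hl a) ih
      rw [Nat.sub_add_cancel hS.card_pos] at hmul
      convert (polyFun G K S.card).add_mem hmul hsplit using 1
      ext g
      simp only [Pi.add_apply, Pi.smul_apply, smul_eq_mul]
      ring

theorem eq_of_forall_mul_eq_of_closure {s : Set G} (hs : Subgroup.closure s = ⊤) {α : Type*}
    {f : G → α} (hf : ∀ x ∈ s, ∀ h, f (x * h) = f h) (g : G) : f g = f 1 := by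
  suffices ∀ h, f (g * h) = f h by simpa only [mul_one] using this 1
  induction (hs ▸ Subgroup.mem_top g : g ∈ Subgroup.closure s)
    using Subgroup.closure_induction with
  | mem x hx => exact hf x hx
  | one => exact fun h => by rw [one_mul]
  | mul x y _ _ hx hy => exact fun h => by rw [mul_assoc, hx, hy]
  | inv x _ hx => exact fun h => by rw [← hx, mul_inv_cancel_left]

theorem finite_polyFun [IsNoetherianRing K] [Group.FG G] (n : ℕ) :
    Module.Finite K (polyFun G K n) := by
  induction n with
  | zero => exact inferInstanceAs (Module.Finite K (⊥ : Submodule K (G → K)))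
  | succ n ih =>
    obtain ⟨S, hS⟩ := Group.fg_def.1 ‹Group.FG G›
    let T : polyFun G K (n + 1) →ₗ[K] K × (S → polyFun G K n) :=
      (LinearMap.proj 1 ∘ₗ (polyFun G K (n + 1)).subtype).prod <| LinearMap.pi fun s =>
        (leftDiff K s.1).restrict fun _ hf => mem_polyFun_succ.1 hf s
    refine Module.Finite.of_injective T ((injective_iff_map_eq_zero T).2 fun f hf => ?_)
    have hone : f.1 1 = 0 := congrArg Prod.fst hf
    have hinv : ∀ s ∈ (S : Set G), ∀ h, f.1 (s * h) = f.1 h := fun s hs h =>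
      sub_eq_zero.1 (congrFun (congrArg Subtype.val (congrFun (congrArg Prod.snd hf) ⟨s, hs⟩)) h)
    exact Subtype.ext (funext fun g => (eq_of_forall_mul_eq_of_closure hS hinv g).trans hone)

theorem fwdDiff_iterate_pow_eq_zero {n : ℕ} {f : G → K} (hf : f ∈ polyFun G K n) (g : G) :
    (fwdDiff 1)^[n] (fun s : ℕ => f (g ^ s)) = 0 := by
  induction n generalizing f with
  | zero => exact funext fun s => congrFun hf (g ^ s)
  | succ n ih =>
    rw [Function.iterate_succ_apply, ← ih (mem_polyFun_succ.1 hf g)]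
    refine congrArg _ (funext fun s => ?_)
    simp only [fwdDiff, pow_succ']

theorem eq_zero_of_homogeneous [NoZeroDivisors K] [CharZero K] {n : ℕ} {f : G → K}
    (hf : f ∈ polyFun G K n) {g : G} (hg : ∀ s : ℕ, f (g ^ s) = (s : K) ^ n * f g) : f g = 0 := by
  have hpow : (fun s : ℕ => f (g ^ s)) = fun s : ℕ => f g * (s : K) ^ n :=
    funext fun s => by rw [hg, mul_comm]
  have hfact : (fwdDiff 1)^[n] (fun s : ℕ => f g * (s : K) ^ n) 0 = f g * n.factorial := by
    have h := congrFun (fwdDiff_iter_const_smul (h := (1 : K)) (f g) (fun x : K => x ^ n) n) 0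
    rw [fwdDiff_iter_eq_factorial] at h
    simpa [fwdDiff_iter_eq_sum_shift] using h
  have hzero := congrFun (fwdDiff_iterate_pow_eq_zero hf g) 0
  rw [hpow, hfact] at hzero
  exact (mul_eq_zero.1 hzero).resolve_right (Nat.cast_ne_zero.2 n.factorial_ne_zero)

end PolynomialFunctions

section DimensionSubgroup

open scoped commutatorElement

variable {G K : Type*} [Group G] [CommRing K]

/-- The `n`-th dimension subgroup of `G` over `K`: the elements which no function of degree less
than `n` distinguishes from `1`. -/
def dimensionSubgroup (G K : Type*) [Group G] [CommRing K] (n : ℕ) : Subgroup G where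
  carrier := {z | ∀ f ∈ polyFun G K n, ∀ g, f (z * g) = f g}
  mul_mem' ha hb f hf g := by rw [mul_assoc, ha f hf, hb f hf]
  one_mem' f _ g := by rw [one_mul]
  inv_mem' {a} ha f hf g := by rw [← ha f hf, mul_inv_cancel_left]

theorem mem_dimensionSubgroup {n : ℕ} {z : G} :
    z ∈ dimensionSubgroup G K n ↔ ∀ f ∈ polyFun G K n, f z = f 1 :=
  ⟨fun h f hf => by simpa only [mul_one] using h f hf 1,
    fun h f hf g => by simpa only [one_mul] using h _ (comp_mul_right_mem_polyFun hf g)⟩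

theorem mem_dimensionSubgroup_one (z : G) : z ∈ dimensionSubgroup G K 1 :=
  fun _ hf _ => eq_of_mem_polyFun_one hf _ _

theorem dimensionSubgroup_antitone : Antitone (dimensionSubgroup G K) :=
  fun _ _ h _ hz f hf => hz f (polyFun_mono h hf)

instance dimensionSubgroup_normal (n : ℕ) : (dimensionSubgroup G K n).Normal where
  conj_mem z hz x f hf g := by
    simpa only [mul_assoc, mul_inv_cancel_left] using
      hz _ (comp_mul_left_mem_polyFun hf x) (x⁻¹ * g)

theorem apply_mul_of_mem_dimensionSubgroup {n : ℕ} {f : G → K} (hf : f ∈ polyFun G K (n + 1))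
    {z : G} (hz : z ∈ dimensionSubgroup G K n) (g : G) : f (g * z) = f g + f z - f 1 := by
  have h := mem_dimensionSubgroup.1 hz _ (mem_polyFun_succ.1 hf g)
  rw [mul_one] at h
  linear_combination h

theorem apply_mul_of_mem_dimensionSubgroup' {n : ℕ} {f : G → K} (hf : f ∈ polyFun G K (n + 1))
    {z : G} (hz : z ∈ dimensionSubgroup G K n) (g : G) : f (z * g) = f z + f g - f 1 := by
  have h := mem_dimensionSubgroup.1 hz _ (rightDiff_mem_polyFun hf g)
  rw [one_mul] at h
  linear_combination h

theorem apply_pow_of_mem_dimensionSubgroup {n : ℕ} {f : G → K} (hf : f ∈ polyFun G K (n + 1))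
    {z : G} (hz : z ∈ dimensionSubgroup G K n) (k : ℕ) :
    f (z ^ k) = f 1 + k * (f z - f 1) := by
  induction k with
  | zero => simp
  | succ k ih =>
    rw [pow_succ, apply_mul_of_mem_dimensionSubgroup hf hz, ih]
    push_cast
    ring

theorem commutator_mem_dimensionSubgroup {n : ℕ} {z : G} (hz : z ∈ dimensionSubgroup G K n)
    (u : G) : ⁅u, z⁆ ∈ dimensionSubgroup G K (n + 1) := by
  refine mem_dimensionSubgroup.2 fun f hf => ?_
  have hconj : u * z * u⁻¹ ∈ dimensionSubgroup G K n :=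
    (dimensionSubgroup_normal n).conj_mem z hz u
  have h₁ := apply_mul_of_mem_dimensionSubgroup hf hz ⁅u, z⁆
  have h₂ := apply_mul_of_mem_dimensionSubgroup' hf hconj u
  have h₃ := apply_mul_of_mem_dimensionSubgroup hf hz u
  simp only [commutatorElement_def, inv_mul_cancel_right] at h₁ h₂ ⊢
  linear_combination -h₁ - h₂ + h₃

end DimensionSubgroup

section Reidemeister

variable {G : Type*} [Group G]

theorem reidemeisterNumber_eq_top_of_pairwise {φ : G ≃* G} {ι : Type*} [Infinite ι] {s : ι → G}
    (hs : ∀ i j, twistedConjSetoid φ (s i) (s j) → i = j) : reidemeisterNumber φ = ⊤ := by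
  have : Infinite (Quotient (twistedConjSetoid φ)) :=
    Infinite.of_injective (fun i => ⟦s i⟧) fun i j h => hs i j (Quotient.exact h)
  exact ENat.card_eq_top_of_infinite

variable {K : Type*} [Field K]

/-- The automorphism `φ` fixes a nontrivial character of the `n`-th layer of the dimension
filtration. Characters are encoded by functions of degree at most `n`, which are additive on
`dimensionSubgroup G K n` up to their value at `1`. -/
def FixesCharacter (K : Type*) [Field K] (φ : G ≃* G) (n : ℕ) : Prop :=
  ∃ f ∈ polyFun G K (n + 1), (∀ z ∈ dimensionSubgroup G K n, f (φ z) = f z) ∧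
    ∃ z ∈ dimensionSubgroup G K n, f z ≠ f 1

theorem exists_comp_sub_eq [Group.FG G] {φ : G ≃* G} {n : ℕ} (hφ : ¬FixesCharacter K φ n)
    {h : G → K} (hh : h ∈ polyFun G K (n + 1)) :
    ∃ f ∈ polyFun G K (n + 1), ∀ z ∈ dimensionSubgroup G K n, f (φ z) - f z = h z - h 1 := by
  have := finite_polyFun (G := G) (K := K) (n + 1)
  let W := polyFun G K (n + 1)
  let D := dimensionSubgroup G K n
  let res : W →ₗ[K] (D → K) :=
    (LinearMap.funLeft K K (↑) - LinearMap.funLeft K K fun _ => 1) ∘ₗ W.subtype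
  let diff : W →ₗ[K] (D → K) :=
    (LinearMap.funLeft K K (fun z : D => φ z) - LinearMap.funLeft K K (↑)) ∘ₗ W.subtype
  have hrange : LinearMap.range diff ≤ LinearMap.range res := by
    rintro _ ⟨f, rfl⟩
    refine ⟨⟨fun g => f.1 (φ g), comp_hom_mem_polyFun f.2 φ.toMonoidHom⟩ - f, ?_⟩
    ext z
    change f.1 (φ z) - f.1 z - (f.1 (φ 1) - f.1 1) = f.1 (φ z) - f.1 z
    rw [map_one, sub_self, sub_zero]
  have hker : LinearMap.ker diff ≤ LinearMap.ker res := fun f hf => by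
    by_contra hres
    obtain ⟨z, hz⟩ := Function.ne_iff.1 hres
    exact hφ ⟨f.1, f.2, fun z hz => sub_eq_zero.1 (congrFun hf ⟨z, hz⟩), z.1, z.2,
      fun h => hz (sub_eq_zero.2 h)⟩
  have hfinrank : Module.finrank K (LinearMap.range res) ≤
      Module.finrank K (LinearMap.range diff) := by
    have := Submodule.finrank_mono hker
    have := res.finrank_range_add_finrank_ker
    have := diff.finrank_range_add_finrank_ker
    omega
  obtain ⟨f, hf⟩ : res ⟨h, hh⟩ ∈ LinearMap.range diff :=
    Submodule.eq_of_le_of_finrank_le hrange hfinrank ▸ LinearMap.mem_range_self res _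
  exact ⟨f.1, f.2, fun z hz => congrFun hf ⟨z, hz⟩⟩

theorem mem_dimensionSubgroup_of_map_mul_inv_mem [Group.FG G] {φ : G ≃* G} {n : ℕ}
    (hφ : ∀ m < n, ¬FixesCharacter K φ m) {x : G}
    (hx : φ x * x⁻¹ ∈ dimensionSubgroup G K n) : x ∈ dimensionSubgroup G K n := by
  induction n with
  | zero =>
    refine mem_dimensionSubgroup.2 fun f hf => ?_
    obtain rfl : f = 0 := hf
    rfl
  | succ n ih =>
    have hxn := ih (fun m hm => hφ m (by omega)) (dimensionSubgroup_antitone n.le_succ hx)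
    refine mem_dimensionSubgroup.2 fun h hh => ?_
    obtain ⟨f, hf, hfh⟩ := exists_comp_sub_eq (hφ n n.lt_succ_self) hh
    have hfx := hx f hf x
    rw [inv_mul_cancel_right] at hfx
    linear_combination -hfh x hxn + hfx

/-- If `n` is least, twisted conjugate powers of an element of the `n`-th dimension subgroup are
so by an element of that subgroup, hence have the same image under the fixed character. -/
theorem reidemeisterNumber_eq_top_of_fixesCharacter [Group.FG G] [CharZero K] {φ : G ≃* G}
    (hφ : ∃ n, FixesCharacter K φ n) : reidemeisterNumber φ = ⊤ := by
  classical
  have hmin (m : ℕ) (hm : m < Nat.find hφ) : ¬FixesCharacter K φ m := Nat.find_min hφ hm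
  obtain ⟨f, hf, hinv, z, hz, hfz⟩ := Nat.find_spec hφ
  refine reidemeisterNumber_eq_top_of_pairwise (s := fun k : ℕ => z ^ k) ?_
  rintro k l ⟨x, hx⟩
  have hzk := pow_mem hz k
  have hzl := pow_mem hz l
  have hxn : x ∈ dimensionSubgroup G K (Nat.find hφ) := by
    refine mem_dimensionSubgroup_of_map_mul_inv_mem hmin ?_
    have hconj : φ x * x⁻¹ = z ^ l * (x * (z ^ k)⁻¹ * x⁻¹) := by
      rw [eq_mul_inv_of_mul_eq hx]
      group
    exact hconj ▸ mul_mem hzl ((dimensionSubgroup_normal _).conj_mem _ (inv_mem hzk) x)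
  have hfx := congrArg f hx
  rw [apply_mul_of_mem_dimensionSubgroup hf hzk, apply_mul_of_mem_dimensionSubgroup hf hxn,
    hinv x hxn, apply_pow_of_mem_dimensionSubgroup hf hz,
    apply_pow_of_mem_dimensionSubgroup hf hz] at hfx
  have hkl : ((k : K) - l) * (f z - f 1) = 0 := by linear_combination hfx
  exact Nat.cast_injective <|
    sub_eq_zero.1 ((mul_eq_zero.1 hkl).resolve_right (sub_ne_zero.2 hfz))

end Reidemeister

section CrossedHom

open scoped commutatorElement

variable {G V K : Type*} [Group G]

/-- A crossed homomorphism from `G` to the functions on a group `V`, on which `G` acts through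
`v : G →* V` by right translations. We think of `J g p` as the integral of a 1-form along the path
that starts at `p` and is traced out by `g`. -/
def IsCrossedHom [Group V] [AddCommGroup K] (v : G →* V) (J : G → V → K) : Prop :=
  ∀ g h p, J (g * h) p = J g p + J h (p * v g)

namespace IsCrossedHom

section AddCommGroup

variable [Group V] [AddCommGroup K] {v : G →* V} {J J' : G → V → K}

protected theorem map_one (hJ : IsCrossedHom v J) (p : V) : J 1 p = 0 := by
  simpa only [mul_one, map_one, left_eq_add] using hJ 1 1 p

protected theorem map_inv (hJ : IsCrossedHom v J) (g : G) (p : V) :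
    J g⁻¹ p = -J g (p * (v g)⁻¹) := by
  have h := hJ g⁻¹ g p
  rw [inv_mul_cancel, hJ.map_one, map_inv] at h
  exact eq_neg_of_add_eq_zero_left h.symm

protected theorem sub (hJ : IsCrossedHom v J) (hJ' : IsCrossedHom v J') :
    IsCrossedHom v fun g p => J g p - J' g p := fun g h p => by
  simp only [hJ g h, hJ' g h, add_sub_add_comm]

protected theorem comp_mul_left (hJ : IsCrossedHom v J) (w : V) :
    IsCrossedHom v fun g p => J g (w * p) := fun g h p => by
  simp only [hJ g h, mul_assoc]

protected theorem comp_hom (hJ : IsCrossedHom v J) {φ : G →* G} {A : V →* V}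
    (hA : ∀ g, v (φ g) = A (v g)) : IsCrossedHom v fun g p => J (φ g) (A p) := fun g h p => by
  simp only [map_mul, hJ (φ g) (φ h), hA]

end AddCommGroup

section CommRing

variable [Group V] [CommRing K] {v : G →* V} {J : G → V → K}

theorem mem_polyFun_of_closure (hJ : IsCrossedHom v J) {n : ℕ} {s : Set G}
    (hs : Subgroup.closure s = ⊤) (hJs : ∀ g ∈ s, J g ∈ polyFun V K n) (g : G) :
    J g ∈ polyFun V K n := by
  induction (hs ▸ Subgroup.mem_top g : g ∈ Subgroup.closure s)
    using Subgroup.closure_induction with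
  | mem g hg => exact hJs g hg
  | one => exact (funext hJ.map_one : J 1 = 0) ▸ Submodule.zero_mem _
  | mul g h _ _ hg hh =>
    rw [funext (hJ g h)]
    exact Submodule.add_mem _ hg (comp_mul_right_mem_polyFun hh (v g))
  | inv g _ hg =>
    rw [funext (hJ.map_inv g)]
    exact Submodule.neg_mem _ (comp_mul_right_mem_polyFun hg (v g)⁻¹)

theorem apply_mem_polyFun (hJ : IsCrossedHom v J) {n : ℕ} (hn : ∀ g, J g ∈ polyFun V K n)
    (p : V) : (fun g => J g p) ∈ polyFun G K (n + 1) := by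
  induction n generalizing J with
  | zero =>
    have hzero (g : G) : J g = 0 := hn g
    simpa only [hzero, Pi.zero_apply] using const_mem_polyFun 0 (0 : K)
  | succ n ih =>
    refine mem_polyFun_succ.2 fun x => ?_
    have hdiff := ih ((hJ.comp_mul_left (p * v x * p⁻¹)).sub hJ)
      fun g => mem_polyFun_succ.1 (hn g) _
    convert Submodule.add_mem _ (const_mem_polyFun n (J x p)) hdiff using 1
    ext g
    simp only [hJ x g, inv_mul_cancel_right, Pi.add_apply]
    ring

/-- The leading terms of the values of a crossed homomorphism of degree at most `n`. They are
additive because translations do not affect leading terms. -/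
def leadingHom (hJ : IsCrossedHom v J) {n : ℕ} (hn : ∀ g, J g ∈ polyFun V K (n + 1)) :
    G →* Multiplicative ((V → K) ⧸ polyFun V K n) :=
  MonoidHom.mk' (fun g => .ofAdd (Submodule.Quotient.mk (J g))) fun g h => by
    rw [← ofAdd_add, ← Submodule.Quotient.mk_add]
    refine congrArg _ ((Submodule.Quotient.eq _).2 ?_)
    convert rightDiff_mem_polyFun (hn h) (v g) using 1
    ext p
    simp only [Pi.sub_apply, Pi.add_apply, hJ g h p]
    ring

end CommRing

variable [CommGroup V] [CommRing K] {v : G →* V} {J : G → V → K}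

protected theorem commutatorElement (hJ : IsCrossedHom v J) (g h : G) (p : V) :
    J ⁅g, h⁆ p = (J h (p * v g) - J h p) - (J g (p * v h) - J g p) := by
  have hg : p * (v g * v h) * (v g)⁻¹ = p * v h := by rw [mul_assoc, mul_inv_cancel_comm]
  have hh : p * (v g * v h * (v g)⁻¹) * (v h)⁻¹ = p := by
    rw [mul_inv_cancel_comm, mul_inv_cancel_right]
  simp only [commutatorElement_def, hJ _ _ p, hJ.map_inv, map_mul, map_inv, hg, hh]
  ring

/-- Commutators with `x : G` act on the values of `J` as difference operators, so `k` of them do not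
kill a function that has degree at least `k`. -/
theorem exists_mem_dimensionSubgroup_ne_zero (hJ : IsCrossedHom v J) {n k : ℕ} {c : G}
    (hc : c ∈ dimensionSubgroup G K n) (hvc : v c = 1)
    (hJc : (fun g => J c (v g)) ∉ polyFun G K k) :
    ∃ z ∈ dimensionSubgroup G K (n + k), J z 1 ≠ 0 := by
  induction k generalizing n c with
  | zero =>
    obtain ⟨g, hg⟩ := Function.ne_iff.1 hJc
    refine ⟨g * c * g⁻¹, (dimensionSubgroup_normal n).conj_mem c hc g, ?_⟩
    refine ne_of_eq_of_ne ?_ hg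
    simp only [hJ _ _ 1, hJ.map_inv, map_mul, hvc, mul_one, one_mul, mul_inv_cancel]
    ring
  | succ k ih =>
    obtain ⟨x, hx⟩ := not_forall.1 (mt mem_polyFun_succ.2 hJc)
    rw [← Nat.add_assoc, Nat.add_right_comm]
    refine ih (commutator_mem_dimensionSubgroup hc x) ?_ ?_
    · rw [map_commutatorElement, hvc, commutatorElement_one_right]
    · convert hx using 2
      ext g
      rw [hJ.commutatorElement, hvc, mul_one, sub_self, sub_zero, map_mul, mul_comm (v g)]

end IsCrossedHom

end CrossedHom

section MetabelianQuotients

open scoped commutatorElement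

theorem derivedSeries_two_eq_bot {H V : Type*} [Group H] [CommGroup V] (f : H →* V)
    (hf : ∀ a b, f a = 1 → f b = 1 → Commute a b) : derivedSeries H 2 = ⊥ := by
  have hker : derivedSeries H 1 ≤ f.ker :=
    derivedSeries_one H ▸ Abelianization.commutator_subset_ker f
  rw [derivedSeries_succ, Subgroup.commutator_eq_bot_iff_le_centralizer]
  exact fun a ha b hb => hf b a (hker hb) (hker ha)

theorem derivedSeries_two_regularWreathProduct {D Q : Type*} [CommGroup D] [CommGroup Q] :
    derivedSeries (RegularWreathProduct D Q) 2 = ⊥ := by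
  refine derivedSeries_two_eq_bot RegularWreathProduct.rightHom fun a b ha hb => ?_
  rw [RegularWreathProduct.rightHom_eq_right] at ha hb
  ext q
  · simp [ha, hb, mul_comm]
  · simp [ha, hb]

variable {X : Type*} {N : Subgroup (FreeGroup X)} [N.Normal]

/-- The image in `F / N` of the free generator `i` of `F`. -/
def generator (N : Subgroup (FreeGroup X)) (i : X) : FreeGroup X ⧸ N :=
  QuotientGroup.mk (FreeGroup.of i)

theorem closure_range_generator : Subgroup.closure (Set.range (generator N)) = ⊤ := by
  have hrange : Set.range (generator N) = QuotientGroup.mk' N '' Set.range FreeGroup.of :=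
    Set.range_comp _ _
  rw [hrange, ← MonoidHom.map_closure, FreeGroup.closure_range_of X,
    Subgroup.map_top_of_surjective _ (QuotientGroup.mk'_surjective N)]

theorem hom_ext_generator {H : Type*} [Group H] {a b : FreeGroup X ⧸ N →* H}
    (h : ∀ i, a (generator N i) = b (generator N i)) : a = b :=
  QuotientGroup.monoidHom_ext N (FreeGroup.ext_hom _ _ h)

/-- The homomorphism from `F / N` to a metabelian group with prescribed values on the generators,
where `N` lies in the second derived subgroup of `F`. -/
def metabelianLift (hN : N ≤ derivedSeries (FreeGroup X) 2) {H : Type*} [Group H]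
    (hH : derivedSeries H 2 = ⊥) (x : X → H) : FreeGroup X ⧸ N →* H :=
  QuotientGroup.lift N (FreeGroup.lift x) fun g hg => by
    rw [MonoidHom.mem_ker, ← Subgroup.mem_bot, ← hH]
    exact map_derivedSeries_le_derivedSeries _ 2 (Subgroup.mem_map_of_mem _ (hN hg))

variable (hN : N ≤ derivedSeries (FreeGroup X) 2)

@[simp]
theorem metabelianLift_generator {H : Type*} [Group H] (hH : derivedSeries H 2 = ⊥) (x : X → H)
    (i : X) : metabelianLift hN hH x (generator N i) = x i :=
  FreeGroup.lift_apply_of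

variable [DecidableEq X]

/-- The exponent sums of the generators, with values in a ring `R`. -/
def coords (R : Type*) [CommRing R] : FreeGroup X ⧸ N →* Multiplicative (X → R) :=
  metabelianLift hN (derivedSeries_two_eq_bot (MonoidHom.id _) fun _ _ _ _ => Commute.all _ _)
    fun i => .ofAdd (Pi.single i 1)

@[simp]
theorem coords_generator (R : Type*) [CommRing R] (i : X) :
    coords hN R (generator N i) = .ofAdd (Pi.single i 1) :=
  metabelianLift_generator ..

theorem coords_intCast (R : Type*) [CommRing R] (g : FreeGroup X ⧸ N) :
    coords hN R g = .ofAdd fun i => ((coords hN ℤ g).toAdd i : R) := by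
  let cast := AddMonoidHom.toMultiplicative ((Int.castAddHom R).compLeft X)
  suffices coords hN R = cast.comp (coords hN ℤ) from DFunLike.congr_fun this g
  refine hom_ext_generator fun i => Multiplicative.toAdd.injective (funext fun j => ?_)
  simp [cast, Pi.single_apply, apply_ite (Int.cast : ℤ → R)]

theorem coords_int_surjective [Finite X] : Function.Surjective (coords hN ℤ) := by
  have := Fintype.ofFinite X
  refine MonoidHom.range_eq_top.1 (eq_top_iff.2 fun p _ => ?_)
  have hp : p = ∏ i, coords hN ℤ (generator N i) ^ p.toAdd i :=
    Multiplicative.toAdd.injective <| funext fun k => by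
      simp [toAdd_prod, Finset.sum_apply, Pi.single_apply]
  rw [hp]
  exact Subgroup.prod_mem _ fun i _ => Subgroup.zpow_mem _ (MonoidHom.mem_range.2 ⟨_, rfl⟩) _

variable {K : Type*} [CommRing K] (ω : Multiplicative (X → K) → X → K)

/-- The Magnus homomorphism to a wreath product that records the values `ω p i` of a function on
the edges from `p` to `p + eᵢ` of the lattice of exponent sums. In the wreath product functions are
translated on the left, whence the inverse. -/
def magnusHom :
    FreeGroup X ⧸ N →* RegularWreathProduct (Multiplicative K) (Multiplicative (X → K)) :=
  metabelianLift hN derivedSeries_two_regularWreathProduct fun i =>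
    ⟨fun q => .ofAdd (ω q⁻¹ i), .ofAdd (Pi.single i 1)⟩

theorem magnusHom_right (g : FreeGroup X ⧸ N) : (magnusHom hN ω g).right = coords hN K g := by
  suffices RegularWreathProduct.rightHom.comp (magnusHom hN ω) = coords hN K from
    DFunLike.congr_fun this g
  exact hom_ext_generator fun i => by simp [magnusHom]

/-- The integral of the 1-form with coefficients `ω p i`, along the path in the lattice of exponent
sums that starts at `p` and is traced out by `g`. -/
def pathIntegral (g : FreeGroup X ⧸ N) (p : Multiplicative (X → K)) : K :=
  ((magnusHom hN ω g).left p⁻¹).toAdd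

@[simp]
theorem pathIntegral_generator (i : X) (p : Multiplicative (X → K)) :
    pathIntegral hN ω (generator N i) p = ω p i := by
  simp only [pathIntegral, magnusHom, metabelianLift_generator, inv_inv, toAdd_ofAdd]

theorem isCrossedHom_pathIntegral : IsCrossedHom (coords hN K) (pathIntegral hN ω) := by
  intro g h p
  simp [pathIntegral, magnusHom_right]

variable {ω}

theorem pathIntegral_mem_polyFun {n : ℕ}
    (hω : ∀ i, (fun p => ω p i) ∈ polyFun (Multiplicative (X → K)) K n) (g : FreeGroup X ⧸ N) :
    pathIntegral hN ω g ∈ polyFun (Multiplicative (X → K)) K n := by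
  refine (isCrossedHom_pathIntegral hN ω).mem_polyFun_of_closure closure_range_generator ?_ g
  rintro _ ⟨i, rfl⟩
  simpa only [← pathIntegral_generator hN ω] using hω i

variable [Fintype X]

theorem pathIntegral_sub_dotProduct_mem_polyFun {n : ℕ}
    (hω : ∀ i, (fun p => ω p i) ∈ polyFun (Multiplicative (X → K)) K (n + 1))
    (g : FreeGroup X ⧸ N) :
    (fun p => pathIntegral hN ω g p - ω p ⬝ᵥ (coords hN K g).toAdd) ∈
      polyFun (Multiplicative (X → K)) K n := by
  have hJ := isCrossedHom_pathIntegral hN ω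
  have hn := pathIntegral_mem_polyFun hN hω
  let pairing := (polyFun (Multiplicative (X → K)) K n).mkQ ∘ₗ (Matrix.of ω).mulVecLin
  have hlead : hJ.leadingHom hn = pairing.toAddMonoidHom.toMultiplicative.comp (coords hN K) :=
    hom_ext_generator fun i => by
      refine congrArg Multiplicative.ofAdd (congrArg Submodule.Quotient.mk (funext fun p => ?_))
      simp
  exact (Submodule.Quotient.eq _).1 (congrArg Multiplicative.toAdd (DFunLike.congr_fun hlead g))

theorem pathIntegral_map_eq_of_mem_dimensionSubgroup
    {φ : (FreeGroup X ⧸ N) →* (FreeGroup X ⧸ N)} {M : Matrix X X K}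
    (hM : ∀ g, (coords hN K (φ g)).toAdd = M.mulVec (coords hN K g).toAdd) {n : ℕ}
    (hω : ∀ i, (fun p => ω p i) ∈ polyFun (Multiplicative (X → K)) K (n + 1))
    (hinv : ∀ p, Matrix.vecMul (ω (.ofAdd (M.mulVec p.toAdd))) M = ω p) {z : FreeGroup X ⧸ N}
    (hz : z ∈ dimensionSubgroup (FreeGroup X ⧸ N) K (n + 1)) :
    pathIntegral hN ω (φ z) 1 = pathIntegral hN ω z 1 := by
  let A : Multiplicative (X → K) →* Multiplicative (X → K) :=
    M.mulVecLin.toAddMonoidHom.toMultiplicative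
  have hJ := isCrossedHom_pathIntegral hN ω
  have hJφ := hJ.comp_hom (φ := φ) (A := A) fun g => Multiplicative.toAdd.injective (hM g)
  have hdiff (g) :
      (fun p => pathIntegral hN ω (φ g) (A p) - pathIntegral hN ω g p) ∈ polyFun _ K n := by
    have h₁ := comp_hom_mem_polyFun (pathIntegral_sub_dotProduct_mem_polyFun hN hω (φ g)) A
    have h₂ := pathIntegral_sub_dotProduct_mem_polyFun hN hω g
    convert Submodule.sub_mem _ h₁ h₂ using 1
    ext p
    have hpair : ω (A p) ⬝ᵥ (coords hN K (φ g)).toAdd = ω p ⬝ᵥ (coords hN K g).toAdd := by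
      rw [hM, Matrix.dotProduct_mulVec]
      exact congrArg (· ⬝ᵥ _) (hinv p)
    simp only [Pi.sub_apply, hpair]
    ring
  have h := mem_dimensionSubgroup.1 hz _ ((hJφ.sub hJ).apply_mem_polyFun hdiff 1)
  simpa [hJ.map_one, sub_eq_zero] using h

end MetabelianQuotients

section InvariantForms

open scoped commutatorElement

variable {X K : Type*} [DecidableEq X] {N : Subgroup (FreeGroup X)} [N.Normal]
  {hN : N ≤ derivedSeries (FreeGroup X) 2}

/-- The integral of the 1-form `ω` around the lattice square at `p` spanned by `e_y` and `e_x`. -/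
def curl [CommRing K] (ω : Multiplicative (X → K) → X → K) (x y : X) (p : Multiplicative (X → K)) :
    K :=
  (ω (p * .ofAdd (Pi.single y 1)) x - ω p x) - (ω (p * .ofAdd (Pi.single x 1)) y - ω p y)

theorem exists_pathIntegral_ne_zero [CommRing K] {ω : Multiplicative (X → K) → X → K} {k : ℕ}
    {x y : X} (hcurl : (fun g => curl ω x y (coords hN K g)) ∉ polyFun (FreeGroup X ⧸ N) K k) :
    ∃ z ∈ dimensionSubgroup (FreeGroup X ⧸ N) K (2 + k), pathIntegral hN ω z 1 ≠ 0 := by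
  have hJ := isCrossedHom_pathIntegral hN ω
  refine hJ.exists_mem_dimensionSubgroup_ne_zero (c := ⁅generator N y, generator N x⁆) ?_ ?_ ?_
  · exact commutator_mem_dimensionSubgroup (mem_dimensionSubgroup_one _) _
  · rw [map_commutatorElement, commutatorElement_eq_one_iff_mul_comm, mul_comm]
  · simpa only [curl, hJ.commutatorElement, pathIntegral_generator, coords_generator] using hcurl

theorem reidemeisterNumber_eq_top_of_invariant_form [Field K] [CharZero K] [Fintype X]
    {φ : (FreeGroup X ⧸ N) ≃* (FreeGroup X ⧸ N)} {M : Matrix X X K}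
    (hM : ∀ g, (coords hN K (φ g)).toAdd = M.mulVec (coords hN K g).toAdd)
    {ω : Multiplicative (X → K) → X → K} {k : ℕ}
    (hω : ∀ i, (fun p => ω p i) ∈ polyFun (Multiplicative (X → K)) K (k + 2))
    (hinv : ∀ p, Matrix.vecMul (ω (.ofAdd (M.mulVec p.toAdd))) M = ω p) {x y : X}
    (hcurl : (fun g => curl ω x y (coords hN K g)) ∉ polyFun (FreeGroup X ⧸ N) K k) :
    reidemeisterNumber φ = ⊤ := by
  have hJ := isCrossedHom_pathIntegral hN ω
  obtain ⟨z, hz, hzne⟩ := exists_pathIntegral_ne_zero hcurl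
  rw [add_comm] at hz
  exact reidemeisterNumber_eq_top_of_fixesCharacter (K := K)
    ⟨k + 2, fun g => pathIntegral hN ω g 1,
      hJ.apply_mem_polyFun (pathIntegral_mem_polyFun hN hω) 1,
      fun _ => pathIntegral_map_eq_of_mem_dimensionSubgroup hN (φ := φ.toMonoidHom) hM hω hinv,
      z, hz, ne_of_ne_of_eq hzne (hJ.map_one 1).symm⟩

end InvariantForms

section ProductsOfLinearForms

open Polynomial

variable {ι X K : Type*} [Field K] [CharZero K] [Fintype X] {S : Finset ι} {l : ι → X → K}

theorem exists_forall_dotProduct_ne_zero (hl : ∀ i ∈ S, l i ≠ 0) :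
    ∃ p : X → K, ∀ i ∈ S, l i ⬝ᵥ p ≠ 0 := by
  classical
  obtain ⟨p, hp⟩ := Module.Dual.exists_forall_ne_zero_of_forall_exists
    (fun i : S => dotProductBilin K K (l i)) fun i => by
      by_contra! h
      exact hl i i.2 (dotProduct_eq_zero _ h)
  exact ⟨p, fun i hi => hp ⟨i, hi⟩⟩

variable [DecidableEq ι] (hl : ∀ i ∈ S, l i ≠ 0) {w : X → K} {i₀ : ι}
  (hi₀ : i₀ ∈ S) (hw : l i₀ ⬝ᵥ w ≠ 0)

include hl hi₀ hw

theorem exists_dirDeriv_prod_dotProduct_ne_zero :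
    ∃ p : X → K, ∑ i ∈ S, (l i ⬝ᵥ w) * ∏ j ∈ S.erase i, l j ⬝ᵥ p ≠ 0 := by
  obtain ⟨p, hp⟩ := exists_forall_dotProduct_ne_zero hl
  -- The restriction of the product to the line `p + s w`, on which it is not constant.
  let q : K[X] := ∏ i ∈ S, (C (l i ⬝ᵥ w) * Polynomial.X + C (l i ⬝ᵥ p))
  have hq₀ : q.eval 0 ≠ 0 := by
    simpa [q, eval_prod, Finset.prod_eq_zero_iff] using hp
  have hq₁ : q.eval (-(l i₀ ⬝ᵥ p) / (l i₀ ⬝ᵥ w)) = 0 := by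
    rw [eval_prod]
    refine Finset.prod_eq_zero hi₀ ?_
    simp only [eval_add, eval_mul, eval_C, eval_X]
    field_simp
    ring
  have hq' : derivative q ≠ 0 := fun h => by
    rw [eq_C_of_derivative_eq_zero h, eval_C] at hq₀ hq₁
    exact hq₀ hq₁
  obtain ⟨s, hs⟩ := (derivative q).exists_eval_ne_zero_of_natDegree_lt_card hq'
    ((Cardinal.natCast_lt_aleph0).trans_le (Cardinal.aleph0_le_mk K))
  refine ⟨p + s • w, ne_of_eq_of_ne ?_ hs⟩
  simp only [q, derivative_prod_finset, eval_finsetSum, eval_mul, eval_prod, eval_add, eval_C,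
    eval_X, derivative_add, derivative_C_mul_X, derivative_C, add_zero, dotProduct_add,
    dotProduct_smul, smul_eq_mul]
  simp only [mul_comm, add_comm]

theorem exists_int_dirDeriv_prod_dotProduct_ne_zero :
    ∃ u : X → ℤ, ∑ i ∈ S, (l i ⬝ᵥ w) * ∏ j ∈ S.erase i, l j ⬝ᵥ (fun x => (u x : K)) ≠ 0 := by
  obtain ⟨p, hp⟩ := exists_dirDeriv_prod_dotProduct_ne_zero hl hi₀ hw
  let P : MvPolynomial X K :=
    ∑ i ∈ S, .C (l i ⬝ᵥ w) * ∏ j ∈ S.erase i, (Matrix.of l).toMvPolynomial j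
  have hP (p : X → K) : P.eval p = ∑ i ∈ S, (l i ⬝ᵥ w) * ∏ j ∈ S.erase i, l j ⬝ᵥ p := by
    simp [P, Matrix.toMvPolynomial_eval_eq_apply, Matrix.mulVec]
  by_contra! h
  have hP₀ : P = 0 := by
    refine MvPolynomial.funext_set (fun _ => Set.range (Int.cast : ℤ → K))
      (fun _ => Set.infinite_range_of_injective Int.cast_injective) fun p hp => ?_
    choose u hu using fun x => hp x (Set.mem_univ x)
    rw [← funext hu, hP, h, map_zero]
  rw [← hP, hP₀, map_zero] at hp
  exact hp rfl

end ProductsOfLinearForms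

section ProductForms

variable {ι X K : Type*} [Field K] [Fintype X] [DecidableEq X]
  {N : Subgroup (FreeGroup X)} [N.Normal] {hN : N ≤ derivedSeries (FreeGroup X) 2}
  {S : Finset ι} {l : ι → X → K} {b : X → K}

theorem curl_prod_smul_sub_dirDeriv_mem_polyFun [DecidableEq ι] (x y : X) :
    (fun p => curl (fun p => (∏ i ∈ S, l i ⬝ᵥ p.toAdd) • b) x y p -
      ∑ i ∈ S, (l i ⬝ᵥ (b x • Pi.single y 1 - b y • Pi.single x 1)) *
        ∏ j ∈ S.erase i, l j ⬝ᵥ p.toAdd) ∈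
      polyFun (Multiplicative (X → K)) K (S.card - 1) := by
  have hdiff (x : X) := rightDiff_prod_additive_sub_mem_polyFun
    (G := Multiplicative (X → K)) S (l := fun i p => l i ⬝ᵥ p.toAdd)
    (fun i p q => dotProduct_add _ _ _) (.ofAdd (Pi.single x 1))
  convert sub_mem (Submodule.smul_mem _ (b x) (hdiff y)) (Submodule.smul_mem _ (b y) (hdiff x))
    using 1
  ext p
  simp only [curl, Pi.smul_apply, Pi.sub_apply, smul_eq_mul, dotProduct_sub, dotProduct_smul,
    sub_mul, Finset.sum_sub_distrib, mul_sub, Finset.mul_sum, toAdd_ofAdd, mul_assoc]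
  ring

variable [CharZero K]

theorem dirDeriv_prod_coords_notMem_polyFun [DecidableEq ι] (hl : ∀ i ∈ S, l i ≠ 0)
    {w : X → K} {i₀ : ι} (hi₀ : i₀ ∈ S) (hw : l i₀ ⬝ᵥ w ≠ 0) :
    (fun g => ∑ i ∈ S, (l i ⬝ᵥ w) * ∏ j ∈ S.erase i, l j ⬝ᵥ (coords hN K g).toAdd) ∉
      polyFun (FreeGroup X ⧸ N) K (S.card - 1) := by
  intro h
  obtain ⟨u, hu⟩ := exists_int_dirDeriv_prod_dotProduct_ne_zero hl hi₀ hw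
  obtain ⟨g, hg⟩ := coords_int_surjective hN (.ofAdd u)
  refine hu ?_
  have hgu : (coords hN K g).toAdd = fun x => (u x : K) := by rw [coords_intCast, hg]; rfl
  rw [← hgu]
  refine eq_zero_of_homogeneous h fun s => ?_
  rw [Finset.mul_sum]
  refine Finset.sum_congr rfl fun i hi => ?_
  simp only [map_pow, toAdd_pow, ← Nat.cast_smul_eq_nsmul K, dotProduct_smul, smul_eq_mul,
    Finset.prod_mul_distrib, Finset.prod_const, Finset.card_erase_of_mem hi]
  ring

theorem reidemeisterNumber_eq_top_of_prod_eigenforms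
    {φ : (FreeGroup X ⧸ N) ≃* (FreeGroup X ⧸ N)} {M : Matrix X X K}
    (hM : ∀ g, (coords hN K (φ g)).toAdd = M.mulVec (coords hN K g).toAdd)
    (hl : ∀ i ∈ S, l i ≠ 0) {μ : ι → K} (hlM : ∀ i ∈ S, Matrix.vecMul (l i) M = μ i • l i)
    {ν : K} (hbM : Matrix.vecMul b M = ν • b) (hμν : (∏ i ∈ S, μ i) * ν = 1)
    {i₀ : ι} (hi₀ : i₀ ∈ S) {x y : X} (hxy : b x * l i₀ y ≠ b y * l i₀ x) :
    reidemeisterNumber φ = ⊤ := by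
  classical
  obtain ⟨k, hk⟩ := Nat.exists_eq_add_one_of_ne_zero (Finset.card_ne_zero_of_mem hi₀)
  refine reidemeisterNumber_eq_top_of_invariant_form (k := k) hM
    (ω := fun p => (∏ i ∈ S, l i ⬝ᵥ p.toAdd) • b) (fun x => ?_) (fun p => ?_) (x := x) (y := y) ?_
  · have hQ := prod_additive_mem_polyFun (G := Multiplicative (X → K)) S
      (l := fun i p => l i ⬝ᵥ p.toAdd) fun i p q => dotProduct_add _ _ _
    rw [hk] at hQ
    convert Submodule.smul_mem _ (b x) hQ using 1
    ext p
    exact mul_comm _ _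
  · have hQ : ∏ i ∈ S, l i ⬝ᵥ M.mulVec p.toAdd = (∏ i ∈ S, μ i) * ∏ i ∈ S, l i ⬝ᵥ p.toAdd := by
      rw [← Finset.prod_mul_distrib]
      refine Finset.prod_congr rfl fun i hi => ?_
      rw [Matrix.dotProduct_mulVec, hlM i hi, smul_dotProduct, smul_eq_mul]
    rw [toAdd_ofAdd, hQ, Matrix.smul_vecMul, hbM, smul_smul, mul_right_comm, hμν, one_mul]
  · intro hcurl
    have hdiff := comp_hom_mem_polyFun
      (curl_prod_smul_sub_dirDeriv_mem_polyFun (S := S) (l := l) (b := b) x y) (coords hN K)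
    refine dirDeriv_prod_coords_notMem_polyFun (hN := hN) hl hi₀
      (w := b x • Pi.single y 1 - b y • Pi.single x 1) ?_ ?_
    · simpa [dotProduct_sub, sub_eq_zero] using hxy
    · rw [hk, Nat.add_sub_cancel] at hdiff ⊢
      simpa only [Pi.sub_def, sub_sub_cancel] using sub_mem hcurl hdiff

end ProductForms

section LeftEigenvectors

open Matrix

variable {X K : Type*} [Field K]

theorem exists_mul_ne_mul_of_notMem_span {f g : X → K} (hf : f ≠ 0)
    (hg : g ∉ Submodule.span K {f}) : ∃ x y, f x * g y ≠ f y * g x := by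
  by_contra! h
  obtain ⟨x, hx⟩ := Function.ne_iff.1 hf
  refine hg (Submodule.mem_span_singleton.2 ⟨g x / f x, funext fun y => ?_⟩)
  rw [Pi.smul_apply, smul_eq_mul, div_mul_eq_mul_div, div_eq_iff hx, mul_comm, ← h x y, mul_comm]

variable [Fintype X]

theorem notMem_span_of_vecMul_eq_smul {M : Matrix X X K} {f g : X → K} {a b : K}
    (hf : f ᵥ* M = a • f) (hg : g ᵥ* M = b • g) (hg₀ : g ≠ 0) (hab : a ≠ b) :
    g ∉ Submodule.span K {f} := by
  rintro h
  obtain ⟨c, rfl⟩ := Submodule.mem_span_singleton.1 h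
  rw [smul_vecMul, hf, smul_comm, ← sub_eq_zero, ← sub_smul] at hg
  exact (smul_ne_zero (sub_ne_zero.2 hab) hg₀) hg

theorem exists_vecMul_eq_smul_add_smul [IsAlgClosed K] [Nontrivial X] (M : Matrix X X K)
    {f : X → K} {a : K} (hf : f ᵥ* M = a • f) :
    ∃ g ∉ Submodule.span K {f}, ∃ b c : K, g ᵥ* M = b • g + c • f := by
  let W := Submodule.span K {f}
  have hW : W ≤ W.comap M.vecMulLinear := by
    refine (Submodule.span_singleton_le_iff_mem _ _).2 ?_
    simpa [hf] using W.smul_mem a (Submodule.mem_span_singleton_self f)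
  have hWtop : W ≠ ⊤ := fun h => by
    have hcard := finrank_span_le_card (R := K) ({f} : Set (X → K))
    rw [show Submodule.span K {f} = ⊤ from h, finrank_top, Module.finrank_fintype_fun_eq_card,
      Set.toFinset_singleton, Finset.card_singleton] at hcard
    exact hcard.not_gt Fintype.one_lt_card
  have := Submodule.Quotient.nontrivial_iff.2 hWtop
  obtain ⟨b, hb⟩ := Module.End.exists_eigenvalue (W.mapQ W M.vecMulLinear hW)
  obtain ⟨v, hv⟩ := hb.exists_hasEigenvector
  obtain ⟨g, rfl⟩ := W.mkQ_surjective v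
  refine ⟨g, fun h => hv.2 ((Submodule.Quotient.mk_eq_zero W).2 h), b, ?_⟩
  have hgb : g ᵥ* M - b • g ∈ W := (Submodule.Quotient.eq W).1 hv.apply_eq_smul
  obtain ⟨c, hc⟩ := Submodule.mem_span_singleton.1 hgb
  exact ⟨c, sub_eq_iff_eq_add'.1 hc.symm⟩

variable [DecidableEq X]

theorem mem_roots_charpoly_iff_exists_vecMul_eq_smul {M : Matrix X X K} {a : K} :
    a ∈ M.charpoly.roots ↔ ∃ v ≠ 0, v ᵥ* M = a • v := by
  rw [Polynomial.mem_roots M.charpoly_monic.ne_zero, Polynomial.IsRoot, eval_charpoly,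
    ← exists_vecMul_eq_zero_iff]
  refine exists_congr fun v => and_congr_right fun _ => ?_
  rw [vecMul_sub, sub_eq_zero, scalar_apply, ← smul_one_eq_diagonal, vecMul_smul, vecMul_one,
    eq_comm]

theorem exists_vecMul_eq_smul_add_smul_of_forall_roots_eq [IsAlgClosed K] [Nontrivial X]
    {M : Matrix X X K} {a : K} (ha : ∀ b ∈ M.charpoly.roots, b = a) {f : X → K}
    (hf : f ᵥ* M = a • f) : ∃ g ∉ Submodule.span K {f}, ∃ c : K, g ᵥ* M = a • g + c • f := by
  obtain ⟨g, hg, b, c, hbc⟩ := exists_vecMul_eq_smul_add_smul M hf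
  suffices b = a from ⟨g, hg, c, this ▸ hbc⟩
  by_contra hba
  have hba' := sub_ne_zero.2 hba
  -- If `b ≠ a` then `g` differs from an eigenvector for `b` by a multiple of `f`.
  refine hba (ha b (mem_roots_charpoly_iff_exists_vecMul_eq_smul.2
    ⟨g + (c / (b - a)) • f, fun h => hg ?_, ?_⟩))
  · rw [eq_neg_of_add_eq_zero_left h, ← neg_smul]
    exact Submodule.smul_mem _ _ (Submodule.mem_span_singleton_self f)
  · ext x
    simp only [add_vecMul, smul_vecMul, hbc, hf, Pi.add_apply, Pi.smul_apply, smul_eq_mul]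
    field_simp
    ring

theorem sq_eq_one_of_forall_roots_eq [Nonempty X] {M : Matrix X X ℤ} (hM : M.det ^ 2 = 1) {a : ℂ}
    (ha : ∀ b ∈ (M.map (Int.cast : ℤ → ℂ)).charpoly.roots, b = a) : a ^ 2 = 1 := by
  let N := M.map (Int.cast : ℤ → ℂ)
  have hroots : N.charpoly.roots = Multiset.replicate (Fintype.card X) a := by
    refine Multiset.eq_replicate.2 ⟨?_, ha⟩
    rw [← (IsAlgClosed.splits _).natDegree_eq_card_roots, charpoly_natDegree_eq_dim]
  have htrace : Fintype.card X * a = (M.trace : ℂ) := by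
    rw [← nsmul_eq_mul, ← Multiset.sum_replicate, ← hroots, ← trace_eq_sum_roots_charpoly]
    simp [N, trace]
  have hdet : a ^ Fintype.card X = (M.det : ℂ) := by
    rw [← Multiset.prod_replicate, ← hroots, ← det_eq_prod_roots_charpoly]
    exact ((Int.castRingHom ℂ).map_det M).symm
  -- The eigenvalue is rational, since its multiple by `card X` is the trace, and a root of unity.
  obtain ⟨q, rfl⟩ : ∃ q : ℚ, (q : ℂ) = a := ⟨M.trace / Fintype.card X, by
    push_cast
    rw [← htrace, mul_div_cancel_left₀ _ (Nat.cast_ne_zero.2 Fintype.card_ne_zero)]⟩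
  have hq : (q ^ 2) ^ Fintype.card X = 1 := by
    have : ((q : ℂ) ^ Fintype.card X) ^ 2 = 1 := by rw [hdet]; exact_mod_cast hM
    rw [pow_right_comm]
    exact_mod_cast this
  exact_mod_cast (pow_eq_one_iff_of_nonneg (sq_nonneg q) Fintype.card_ne_zero).1 hq

end LeftEigenvectors

section FixedCharacters

open Matrix

variable {X K : Type*} [Fintype X] [DecidableEq X] {N : Subgroup (FreeGroup X)} [N.Normal]
  {hN : N ≤ derivedSeries (FreeGroup X) 2} {φ : (FreeGroup X ⧸ N) ≃* (FreeGroup X ⧸ N)}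

theorem reidemeisterNumber_eq_top_of_generalized_eigenforms [Field K] [CharZero K]
    {M : Matrix X X K} (hM : ∀ g, (coords hN K (φ g)).toAdd = M *ᵥ (coords hN K g).toAdd)
    {f g : X → K} {a b c : K} (hf : f ᵥ* M = a • f) (hg : g ᵥ* M = b • g + c • f)
    (hab : a * b = 1) {x y : X} (hxy : f x * g y ≠ f y * g x) : reidemeisterNumber φ = ⊤ := by
  refine reidemeisterNumber_eq_top_of_invariant_form (k := 0) hM
    (ω := fun p => (g ⬝ᵥ p.toAdd) • f - (f ⬝ᵥ p.toAdd) • g) (fun i => ?_) (fun p => ?_)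
    (x := x) (y := y) fun h => ?_
  · have hlinear (v : X → K) (s : K) :
        (fun p : Multiplicative (X → K) => (v ⬝ᵥ p.toAdd) * s) ∈ polyFun _ K 2 :=
      additive_mul_mem_polyFun (fun _ _ => dotProduct_add _ _ _) (const_mem_polyFun 0 s)
    exact sub_mem (hlinear g (f i)) (hlinear f (g i))
  · ext i
    simp only [toAdd_ofAdd, dotProduct_mulVec, sub_vecMul, smul_vecMul, hf, hg, add_dotProduct,
      smul_dotProduct, Pi.sub_apply, Pi.add_apply, Pi.smul_apply, smul_eq_mul]
    linear_combination ((g ⬝ᵥ p.toAdd) * f i - (f ⬝ᵥ p.toAdd) * g i) * hab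
  · have hcurl : 2 * (f x * g y - f y * g x) = 0 := by
      refine Eq.trans ?_ (congrFun h 1)
      simp [curl]
      ring
    exact mul_ne_zero two_ne_zero (sub_ne_zero.2 hxy) hcurl

theorem reidemeisterNumber_eq_top_of_roots_ne [Field K] [IsAlgClosed K] [CharZero K]
    {M : Matrix X X K} (hM : ∀ g, (coords hN K (φ g)).toAdd = M *ᵥ (coords hN K g).toAdd)
    (hdet : M.det ^ 2 = 1) {a b : K} (ha : a ∈ M.charpoly.roots) (hb : b ∈ M.charpoly.roots)
    (hab : a ≠ b) : reidemeisterNumber φ = ⊤ := by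
  classical
  obtain ⟨i₀, rfl⟩ : ∃ i : M.charpoly.roots, (i : K) = a :=
    ⟨Multiset.mkToType _ a ⟨0, Multiset.count_pos.2 ha⟩, rfl⟩
  obtain ⟨i₁, rfl⟩ : ∃ i : M.charpoly.roots, (i : K) = b :=
    ⟨Multiset.mkToType _ b ⟨0, Multiset.count_pos.2 hb⟩, rfl⟩
  choose e he heM using fun i : M.charpoly.roots =>
    mem_roots_charpoly_iff_exists_vecMul_eq_smul.1 (Multiset.coe_mem (x := i))
  obtain ⟨x, y, hxy⟩ := exists_mul_ne_mul_of_notMem_span (he i₀)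
    (notMem_span_of_vecMul_eq_smul (heM i₀) (heM i₁) (he i₁) hab)
  -- Each eigenvalue is used twice because only the square of the determinant is known to be `1`.
  let S : Finset (M.charpoly.roots × Bool) := Finset.univ.erase (i₀, false)
  have hi₁ : (i₁, false) ∈ S := Finset.mem_erase.2
    ⟨fun h => hab (congrArg (fun i : M.charpoly.roots × Bool => (i.1 : K)) h).symm,
      Finset.mem_univ _⟩
  have hprod : (∏ j ∈ S, (j.1 : K)) * i₀ = 1 := by
    rw [Finset.prod_erase_mul Finset.univ (fun j : M.charpoly.roots × Bool => (j.1 : K))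
      (Finset.mem_univ (i₀, false)), Fintype.prod_prod_type]
    simp only [Fintype.prod_bool]
    rw [Finset.prod_mul_distrib, ← Multiset.prod_eq_prod_coe, ← det_eq_prod_roots_charpoly, ← sq,
      hdet]
  exact reidemeisterNumber_eq_top_of_prod_eigenforms hM (l := fun j => e j.1) (fun j _ => he j.1)
    (fun j _ => heM j.1) (heM i₀) hprod hi₁ hxy

theorem reidemeisterNumber_eq_top_of_int_matrix [Nontrivial X] {M : Matrix X X ℤ}
    (hM : ∀ g, (coords hN ℤ (φ g)).toAdd = M *ᵥ (coords hN ℤ g).toAdd) (hdet : M.det ^ 2 = 1) :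
    reidemeisterNumber φ = ⊤ := by
  let M' : Matrix X X ℂ := M.map (Int.cast : ℤ → ℂ)
  have hM' (g) : (coords hN ℂ (φ g)).toAdd = M' *ᵥ (coords hN ℂ g).toAdd := by
    rw [coords_intCast, coords_intCast hN ℂ g, toAdd_ofAdd, hM]
    exact funext ((Int.castRingHom ℂ).map_mulVec M _)
  by_cases hroots : ∀ a ∈ M'.charpoly.roots, ∀ b ∈ M'.charpoly.roots, b = a
  · obtain ⟨a, ha⟩ := IsAlgClosed.exists_root M'.charpoly (by
      simpa only [charpoly_degree_eq_dim] using Nat.cast_ne_zero.2 Fintype.card_ne_zero)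
    have ha' := hroots a ((Polynomial.mem_roots M'.charpoly_monic.ne_zero).2 ha)
    obtain ⟨f, hf₀, hf⟩ := mem_roots_charpoly_iff_exists_vecMul_eq_smul.1
      ((Polynomial.mem_roots M'.charpoly_monic.ne_zero).2 ha)
    obtain ⟨g, hg₀, c, hg⟩ := exists_vecMul_eq_smul_add_smul_of_forall_roots_eq ha' hf
    obtain ⟨x, y, hxy⟩ := exists_mul_ne_mul_of_notMem_span hf₀ hg₀
    exact reidemeisterNumber_eq_top_of_generalized_eigenforms hM' hf hg
      ((sq a).symm.trans (sq_eq_one_of_forall_roots_eq hdet ha')) hxy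
  · push Not at hroots
    obtain ⟨a, ha, b, hb, hba⟩ := hroots
    refine reidemeisterNumber_eq_top_of_roots_ne hM' ?_ hb ha hba
    rw [show M'.det = M.det from ((Int.castRingHom ℂ).map_det M).symm]
    exact_mod_cast hdet

end FixedCharacters

section InducedMatrix

variable {X : Type*} [Fintype X] [DecidableEq X] {N : Subgroup (FreeGroup X)} [N.Normal]
  (hN : N ≤ derivedSeries (FreeGroup X) 2)

/-- The matrix of the endomorphism of `X → ℤ` induced by an endomorphism of `F / N`. -/
def inducedMatrix (φ : (FreeGroup X ⧸ N) →* (FreeGroup X ⧸ N)) : Matrix X X ℤ :=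
  Matrix.of fun i j => (coords hN ℤ (φ (generator N j))).toAdd i

theorem coords_map_eq_inducedMatrix_mulVec (φ : (FreeGroup X ⧸ N) →* (FreeGroup X ⧸ N))
    (g : FreeGroup X ⧸ N) :
    (coords hN ℤ (φ g)).toAdd = (inducedMatrix hN φ).mulVec (coords hN ℤ g).toAdd := by
  let A := (inducedMatrix hN φ).mulVecLin.toAddMonoidHom.toMultiplicative
  suffices (coords hN ℤ).comp φ = A.comp (coords hN ℤ) from DFunLike.congr_fun this g
  refine hom_ext_generator fun i => Multiplicative.toAdd.injective (funext fun j => ?_)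
  simp [A, inducedMatrix]

theorem inducedMatrix_mul_inducedMatrix_symm (φ : (FreeGroup X ⧸ N) ≃* (FreeGroup X ⧸ N)) :
    inducedMatrix hN φ.toMonoidHom * inducedMatrix hN φ.symm.toMonoidHom = 1 := by
  refine Matrix.ext_of_mulVec_single fun i => ?_
  have hφ := coords_map_eq_inducedMatrix_mulVec hN φ.toMonoidHom (φ.symm (generator N i))
  have hφsymm := coords_map_eq_inducedMatrix_mulVec hN φ.symm.toMonoidHom (generator N i)
  simp only [MulEquiv.toMonoidHom_eq_coe, MonoidHom.coe_coe, MulEquiv.apply_symm_apply,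
    coords_generator, toAdd_ofAdd] at hφ hφsymm ⊢
  rw [← Matrix.mulVec_mulVec, ← hφsymm, ← hφ, Matrix.one_mulVec]

theorem det_inducedMatrix_sq (φ : (FreeGroup X ⧸ N) ≃* (FreeGroup X ⧸ N)) :
    (inducedMatrix hN φ.toMonoidHom).det ^ 2 = 1 :=
  Int.isUnit_sq (Matrix.isUnit_det_of_right_inverse (inducedMatrix_mul_inducedMatrix_symm hN φ))

end InducedMatrix

theorem theorem2_general {X : Type*} [Finite X] [Nontrivial X] (N : Subgroup (FreeGroup X))
    [N.Normal] (hN : N ≤ derivedSeries (FreeGroup X) 2) : HasRInfty (FreeGroup X ⧸ N) := by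
  classical
  have := Fintype.ofFinite X
  exact fun φ => reidemeisterNumber_eq_top_of_int_matrix
    (coords_map_eq_inducedMatrix_mulVec hN φ.toMonoidHom) (det_inducedMatrix_sq hN φ)

theorem hasRInfty_freeSolvableGroup {r t : ℕ} (hr : 2 ≤ r) (ht : 2 ≤ t) :
    HasRInfty (FreeSolvableGroup r t) :=
  have := Fin.nontrivial_iff_two_le.2 hr
  theorem2_general _ (derivedSeries_antitone _ ht)

theorem two_le_of_logb_le {x : ℝ} {t : ℕ} (hx : 2 < x) (h : Real.logb 2 x ≤ t) : 2 ≤ t := by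
  have hlog : 1 < Real.logb 2 x := by
    rwa [Real.lt_logb_iff_rpow_lt one_lt_two (two_pos.trans hx), Real.rpow_one]
  exact_mod_cast hlog.trans_le h

theorem theorem2 :
    ((∀ t : ℕ, 2 ≤ t → HasRInfty (FreeSolvableGroup 2 t)) ∧ HasRInfty (FreeMetabelianGroup 2)) ∧
    (∀ t : ℕ, 4 ≤ t → HasRInfty (FreeSolvableGroup 3 t)) ∧
    (∀ r t : ℕ, 4 ≤ r → Real.logb 2 (2 * (r : ℝ) + 1) ≤ (t : ℝ) →
      HasRInfty (FreeSolvableGroup r t)) := by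
  refine ⟨⟨fun t ht => hasRInfty_freeSolvableGroup le_rfl ht,
    hasRInfty_freeSolvableGroup le_rfl le_rfl⟩,
    fun t ht => hasRInfty_freeSolvableGroup (by lia) (by lia), fun r t hr hlog => ?_⟩
  have hr' : (4 : ℝ) ≤ r := by exact_mod_cast hr
  exact hasRInfty_freeSolvableGroup (by lia) (two_le_of_logb_le (by linarith) hlog)
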